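/- Let $E=(E^0,E^1,r,s)$ be an arbitrary directed graph, of any cardinality, with range and source maps $r,s\colon E^1\to E^0$. A finite path is a vertex $v$ (of length $0$, with $s(v)=r(v)=v$) or a finite sequence of edges $\alpha=\alpha_1\cdots\alpha_n$ with $r(\alpha_i)=s(\alpha_{i+1})$, and then $s(\alpha)=s(\alpha_1)$, $r(\alpha)=r(\alpha_n)$, $|\alpha|=n$; an infinite path is a sequence of edges $p_1p_2\cdots$ with $r(p_i)=s(p_{i+1})$ for all $i$. A vertex $v$ is singular if $s^{-1}(v)$ is empty or infinite. Let $\partial E$ be the set of all infinite paths and all finite paths whose range is singular. For $k\in\mathbb Z$ and $x,y\in\partial E$ write $x\sim_k y$ if deleting the first $m$ edges of $x$ and the first $n$ edges of $y$ gives the same boundary path, for some integers $0\le m\le |x|$, $0\le n\le |y|$ with $m-n=k$. The boundary path groupoid is $\mathcal G_E=\{(x,k,y)\in\partial E\times\mathbb Z\times\partial E : x\sim_k y\}$, where $(x,k,y)$ has domain $y$ and codomain $x$, $(x,k,y)(y,l,z)=(x,k+l,z)$ and $(x,k,y)^{-1}=(y,-k,x)$; its unit space is $\mathcal G_E^{(0)}=\{(x,0,x):x\in\partial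 E\}$. It has the topology generated by the sets $$\mathcal Z(\alpha,\beta,F)=\mathcal Z(\alpha,\beta)\setminus\bigcup_{e\in F}\mathcal Z(\alpha e,\beta e),\qquad \mathcal Z(\alpha,\beta)=\{(\alpha x,|\alpha|-|\beta|,\beta x): x\in\partial E,\ s(x)=r(\alpha)\},$$ where $\alpha,\beta$ are finite paths with $r(\alpha)=r(\beta)$ and $F$ is a finite set of edges with source $r(\alpha)$. Then the following are equivalent: 1. $\mathcal G_E$ is effective, that is, the interior in $\mathcal G_E$ of the isotropy subgroupoid $\{(x,k,y)\in\mathcal G_E : x=y\}$ equals $\mathcal G_E^{(0)}$; 2. $\mathcal G_E$ is topologically principal, that is, the set of units $u$ such that $u$ is the only element of $\mathcal G_E$ with domain and codomain $u$ is dense in $\mathcal G_E^{(0)}$; 3. $E$ satisfies Condition (L): every cycle has an exit. Here a cycle is a finite path $c=c_1\cdots c_n$ with $n\ge 1$ and $r(c)=s(c)$ such that $s(c_1),\dots,s(c_n)$ are distinct, and an exit for $c$ is an edge $f$ with $s(f)=s(c_i)$ and $f\ne c_i$ for some $i$. -/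

import Mathlib

universe u v

/-! ### Directed graphs and their paths -/

/-- A directed graph `(E⁰, E¹, r, s)` with vertex set `V`, edge set `A`, source map `s` and range
map `r`.  No countability or finiteness is imposed. -/
structure DirGraph (V : Type u) (A : Type v) where
  s : A → V
  r : A → V

namespace DirGraph

variable {V : Type u} {A : Type v}

/-- A vertex is singular if it is a sink or an infinite emitter. -/
def IsSingular (E : DirGraph V A) (w : V) : Prop :=
  {e : A | E.s e = w} = ∅ ∨ {e : A | E.s e = w}.Infinite

/-- A finite path: a list `α₁ … αₙ` of edges with `r αᵢ = s αᵢ₊₁`, together with its source.  If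
`n > 0` the source is `s α₁`; for `n = 0` the path is just a vertex. -/
@[ext]
structure FinPath (E : DirGraph V A) where
  source : V
  edges : List A
  source_eq : ∀ e ∈ edges.head?, E.s e = source
  chain : edges.IsChain (fun e f => E.r e = E.s f)

/-- An infinite path `p₀ p₁ p₂ …`. -/
@[ext]
structure InfPath (E : DirGraph V A) where
  edge : ℕ → A
  chain : ∀ i, E.r (edge i) = E.s (edge (i + 1))

variable {E : DirGraph V A}

namespace FinPath

/-- The length `|α|`. -/
def length (α : E.FinPath) : ℕ := α.edges.length

/-- The range of a finite path: `r αₙ` if `n > 0`, and the vertex itself if `n = 0`. -/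
def range (α : E.FinPath) : V := (α.edges.getLast?.map E.r).getD α.source

/-- A closed path: a finite path of positive length whose range is its source. -/
def IsClosedPath (α : E.FinPath) : Prop := 0 < α.length ∧ α.range = α.source

/-- A cycle: a closed path for which no vertex among `s α₁, …, s αₙ` is repeated. -/
def IsCycle (α : E.FinPath) : Prop := α.IsClosedPath ∧ (α.edges.map E.s).Nodup

/-- `f` is an exit for `α`: for some `i`, `s f = s αᵢ` but `f ≠ αᵢ`. -/
def IsExit (α : E.FinPath) (f : A) : Prop :=
  ∃ (i : ℕ) (hi : i < α.edges.length), E.s f = E.s α.edges[i] ∧ f ≠ α.edges[i]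

/-- The concatenation `αβ` of finite paths with `r α = s β`. -/
def append (α β : E.FinPath) (h : α.range = β.source) : E.FinPath where
  source := α.source
  edges := α.edges ++ β.edges
  source_eq := by
    intro e he
    rcases hα : α.edges with _ | ⟨a, l⟩
    · have h' : α.source = β.source := by simpa [range, hα] using h
      rw [h']
      exact β.source_eq e (by simpa [hα] using he)
    · exact α.source_eq e (by simpa [hα] using he)
  chain := by
    refine List.isChain_append.2 ⟨α.chain, β.chain, ?_⟩
    intro x hx y hy
    have hx' : α.edges.getLast? = some x := hx
    have h' : E.r x = β.source := by simpa [range, hx'] using h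
    rw [h', β.source_eq y hy]

theorem range_append (α β : E.FinPath) (h : α.range = β.source) :
    (α.append β h).range = β.range := by
  rcases hβ : β.edges.getLast? with _ | b
  · have hb : β.edges = [] := List.getLast?_eq_none_iff.1 hβ
    have h1 : (α.append β h).range = α.range := by simp [range, append, hb]
    have h2 : β.range = β.source := by simp [range, hb]
    rw [h1, h2, h]
  · simp [range, append, List.getLast?_append, hβ]

/-- A single edge, as a path of length one. -/
def ofEdge (E : DirGraph V A) (e : A) : E.FinPath where
  source := E.s e
  edges := [e]
  source_eq := by simp
  chain := by simp

/-- The path `αe`, where `α` is a finite path and `e` is an edge with `s e = r α`. -/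
def snoc (α : E.FinPath) (e : A) (h : α.range = E.s e) : E.FinPath :=
  α.append (ofEdge E e) h

end FinPath

/-- The concatenation `αp` of a finite path `α` and an infinite path `p` with `r α = s p`. -/
def InfPath.prepend (α : E.FinPath) (p : E.InfPath) (h : α.range = E.s (p.edge 0)) :
    E.InfPath where
  edge i := if hi : i < α.edges.length then α.edges[i] else p.edge (i - α.edges.length)
  chain := by
    intro i
    by_cases h1 : i + 1 < α.edges.length
    · have h0 : i < α.edges.length := by omega
      simp only [h1, h0, dite_true]
      exact List.isChain_iff_getElem.1 α.chain i h1
    · by_cases h0 : i < α.edges.length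
      · have hl : α.edges.getLast? = some α.edges[i] := by
          rw [List.getLast?_eq_getElem?, show α.edges.length - 1 = i by omega]
          exact List.getElem?_eq_getElem h0
        have h' : E.r α.edges[i] = E.s (p.edge 0) := by simpa [FinPath.range, hl] using h
        simp only [h1, h0, dite_true, dite_false]
        rw [show i + 1 - α.edges.length = 0 by omega, h']
      · simp only [h1, h0, dite_false]
        rw [show i + 1 - α.edges.length = (i - α.edges.length) + 1 by omega]
        exact p.chain _

/-! ### Boundary paths and the shift -/

/-- The boundary paths: infinite paths, and finite paths whose range is a singular vertex. -/
inductive BoundaryPath (E : DirGraph V A)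
  | fin (α : E.FinPath) (h : E.IsSingular α.range) : BoundaryPath E
  | inf (p : E.InfPath) : BoundaryPath E

namespace BoundaryPath

/-- The source of a boundary path. -/
def source : E.BoundaryPath → V
  | fin α _ => α.source
  | inf p => E.s (p.edge 0)

/-- The concatenation `αx` of a finite path `α` and a boundary path `x` with `r α = s x`. -/
def prepend (α : E.FinPath) : (x : E.BoundaryPath) → (α.range = x.source) → E.BoundaryPath
  | fin β hβ, h => fin (α.append β h) ((FinPath.range_append α β h).symm ▸ hβ)
  | inf p, h => inf (p.prepend α h)

/-- The shift `σ`, which deletes the first edge.  It is undefined (`none`) exactly on the paths of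
length zero; a path of length one is sent to its range. -/
def shift : E.BoundaryPath → Option E.BoundaryPath
  | fin ⟨_, [], _, _⟩ _ => none
  | fin ⟨w, e :: l, hs, hc⟩ h => some (fin
      ⟨E.r e, l, fun f hf => ((List.isChain_cons.1 hc).1 f hf).symm, (List.isChain_cons.1 hc).2⟩
      (by
        have hr : FinPath.range ⟨E.r e, l, fun f hf => ((List.isChain_cons.1 hc).1 f hf).symm,
            (List.isChain_cons.1 hc).2⟩ = FinPath.range ⟨w, e :: l, hs, hc⟩ := by
          rcases l with _ | ⟨a, l⟩ <;> simp [FinPath.range, List.getLast?_cons]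
        rw [hr]; exact h))
  | inf p => some (inf ⟨fun i => p.edge (i + 1), fun i => p.chain (i + 1)⟩)

/-- The `n`-fold composition `σⁿ`, defined on the paths of length at least `n`. -/
def shiftN : ℕ → E.BoundaryPath → Option E.BoundaryPath
  | 0, x => some x
  | n + 1, x => (shift x).bind (shiftN n)

theorem shiftN_add (m n : ℕ) (x : E.BoundaryPath) :
    shiftN (m + n) x = (shiftN m x).bind (shiftN n) := by
  induction m generalizing x with
  | zero => simp [shiftN]
  | succ m ih =>
    rw [show m + 1 + n = (m + n) + 1 by omega]
    simp only [shiftN, Option.bind_assoc]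
    congr 1
    funext y
    exact ih y

/-- `x ∼ₖ y` (tail equivalence with lag `k`): `σᵐ x` and `σⁿ y` are defined and equal for some
`m, n ≥ 0` with `m - n = k`. -/
def TailEquiv (k : ℤ) (x y : E.BoundaryPath) : Prop :=
  ∃ m n : ℕ, (m : ℤ) - n = k ∧ ∃ z, shiftN m x = some z ∧ shiftN n y = some z

theorem TailEquiv.refl (x : E.BoundaryPath) : TailEquiv 0 x x :=
  ⟨0, 0, by simp, x, rfl, rfl⟩

theorem TailEquiv.symm {k : ℤ} {x y : E.BoundaryPath} (h : TailEquiv k x y) :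
    TailEquiv (-k) y x := by
  obtain ⟨m, n, hk, z, hx, hy⟩ := h
  exact ⟨n, m, by omega, z, hy, hx⟩

theorem TailEquiv.trans {k l : ℤ} {x y z : E.BoundaryPath} (h : TailEquiv k x y)
    (h' : TailEquiv l y z) : TailEquiv (k + l) x z := by
  obtain ⟨m, n, hk, a, hx, hy⟩ := h
  obtain ⟨m', n', hl, b, hy', hz⟩ := h'
  rcases le_total n m' with hle | hle
  · obtain ⟨d, rfl⟩ := Nat.exists_eq_add_of_le hle
    rw [shiftN_add, hy, Option.bind_some] at hy'
    refine ⟨m + d, n', by push_cast at hl ⊢; omega, b, ?_, hz⟩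
    rw [shiftN_add, hx, Option.bind_some, hy']
  · obtain ⟨d, rfl⟩ := Nat.exists_eq_add_of_le hle
    rw [shiftN_add, hy', Option.bind_some] at hy
    refine ⟨m, n' + d, by push_cast at hk ⊢; omega, a, hx, ?_⟩
    rw [shiftN_add, hz, Option.bind_some, hy]

end BoundaryPath

end DirGraph

/-! ### Topological properties of groupoids -/

namespace TopGroupoid

open CategoryTheory

variable (C : Type u) [Groupoid.{v} C]

/-- The unit space `G⁰`, as a subset of the set `Quiver.Total C` of all morphisms. -/
def units : Set (Quiver.Total C) := Set.range fun x : C => ⟨x, x, 𝟙 x⟩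

/-- The isotropy subgroupoid: all morphisms whose domain and codomain agree. -/
def isotropy : Set (Quiver.Total C) := {g | g.left = g.right}

/-- The groupoid is effective: the interior of the isotropy subgroupoid is the unit space. -/
def IsEffective [TopologicalSpace (Quiver.Total C)] : Prop :=
  interior (isotropy C) = units C

/-- The groupoid is topologically principal: the units `x` whose isotropy group `xGx` is `{x}` are
dense in the unit space (with the subspace topology). -/
def IsTopologicallyPrincipal [TopologicalSpace (Quiver.Total C)] : Prop :=
  Dense {x : units C | {g : Quiver.Total C | g.right = x.1.left ∧ g.left = x.1.left} = {x.1}}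

end TopGroupoid

/-! ### The boundary path groupoid -/

namespace DirGraph

open CategoryTheory

variable {V : Type u} {A : Type v}

/-- The boundary path groupoid `G_E`.  Its objects are the boundary paths.  A morphism with domain
`y` and codomain `x` is an integer `k` with `x ∼ₖ y`, that is, a triple `(x, k, y)`; composition
adds the integers and inversion negates them. -/
instance boundaryPathGroupoid (E : DirGraph V A) : Groupoid E.BoundaryPath where
  Hom y x := {k : ℤ // BoundaryPath.TailEquiv k x y}
  id x := ⟨0, BoundaryPath.TailEquiv.refl x⟩
  comp h g := ⟨g.1 + h.1, g.2.trans h.2⟩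
  id_comp f := Subtype.ext (add_zero f.1)
  comp_id f := Subtype.ext (zero_add f.1)
  assoc f g h := Subtype.ext (add_assoc h.1 g.1 f.1).symm
  inv g := ⟨-g.1, g.2.symm⟩
  inv_comp g := Subtype.ext (add_neg_cancel g.1)
  comp_inv g := Subtype.ext (neg_add_cancel g.1)

/-- The underlying set `{(x, k, y) | x ∼ₖ y}` of the boundary path groupoid: all its morphisms. -/
abbrev GE (E : DirGraph V A) := Quiver.Total E.BoundaryPath

variable {E : DirGraph V A}

/-- The integer `k` of a morphism `(x, k, y)`. -/
def GE.lag (g : E.GE) : ℤ := Subtype.val g.hom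

/-- `Z(α, β)`: the set of all `(αx, |α| - |β|, βx)`, where `x` is a boundary path with source
`r α = r β`. -/
def basicZ (α β : E.FinPath) : Set E.GE :=
  {g | ∃ (x : E.BoundaryPath) (hα : α.range = x.source) (hβ : β.range = x.source),
    g.right = x.prepend α hα ∧ GE.lag g = (α.length : ℤ) - β.length ∧ g.left = x.prepend β hβ}

/-- `Z(α, β, F)`: the set `Z(α, β)` with `Z(αe, βe)` removed for all `e ∈ F`. -/
def basicZF (α β : E.FinPath) (F : Finset A) : Set E.GE :=
  basicZ α β \ {g | ∃ e ∈ F, ∃ (hα : α.range = E.s e) (hβ : β.range = E.s e),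
    g ∈ basicZ (α.snoc e hα) (β.snoc e hβ)}

/-- The topology of `G_E`: it is generated by the sets `Z(α, β, F)`, where `r α = r β` and `F` is a
finite set of edges with source `r α`. -/
instance topologyGE (E : DirGraph V A) : TopologicalSpace E.GE :=
  TopologicalSpace.generateFrom
    {S | ∃ (α β : E.FinPath) (F : Finset A), α.range = β.range ∧ (∀ e ∈ F, E.s e = α.range) ∧
      S = basicZF α β F}

/-- Condition (L): every cycle has an exit. -/
def ConditionL (E : DirGraph V A) : Prop :=
  ∀ c : E.FinPath, c.IsCycle → ∃ f : A, c.IsExit f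

end DirGraph

/-! Both topological properties reduce to isotropy: call a boundary path aperiodic if only lag `0`
relates it to itself. The key point is that, under Condition (L), every vertex is the source of an
aperiodic boundary path (`ConditionL.exists_isAperiodic`). The usual construction is replaced by a
Baire category argument, valid for graphs of any cardinality. If no boundary path from `w` is
aperiodic, all are infinite and eventually periodic, so the closed set of paths from `w` in the
countable product `ℕ → A`, with `A` discrete, is a countable union of closed sets indexed by
preperiod and period. One of these has interior, so some path is determined by a finite initial
segment. Being periodic, it runs through a cycle beyond that segment, and an exit of the cycle gives
a second path with the same segment. Since each open set contains around each of its points a set of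
all `(αx, |α| - |β|, βx)` with first edge of `x` outside a finite set (`isZNhd_of_isOpen`),
replacing `x` by an aperiodic path yields effectiveness and topological principality. Conversely,
all boundary paths from the source of a cycle `c` without exit coincide
(`FinPath.IsCycle.eq_of_source_eq`). That path is an isolated unit with isotropy of lag `|c|`, which
contradicts both properties. -/

namespace DirGraph

variable {V : Type u} {A : Type v} {E : DirGraph V A}

/-! ### Elementary finite paths. -/

namespace FinPath

/-- The path of length zero at a vertex. -/
def nil (E : DirGraph V A) (w : V) : E.FinPath where
  source := w
  edges := []
  source_eq := by simp
  chain := by simp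

@[simp] theorem range_nil (w : V) : (nil E w).range = w := rfl

@[simp] theorem source_nil (w : V) : (nil E w).source = w := rfl

@[simp] theorem length_nil (w : V) : (nil E w).length = 0 := rfl

@[simp] theorem source_ofEdge (e : A) : (ofEdge E e).source = E.s e := rfl

@[simp] theorem edges_ofEdge (e : A) : (ofEdge E e).edges = [e] := rfl

@[simp] theorem length_ofEdge (e : A) : (ofEdge E e).length = 1 := rfl

@[simp] theorem source_append (α β : E.FinPath) (h : α.range = β.source) :
    (α.append β h).source = α.source := rfl

@[simp] theorem edges_append (α β : E.FinPath) (h : α.range = β.source) :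
    (α.append β h).edges = α.edges ++ β.edges := rfl

@[simp] theorem range_ofEdge (e : A) : (ofEdge E e).range = E.r e := rfl

@[simp] theorem length_append (α β : E.FinPath) (h : α.range = β.source) :
    (α.append β h).length = α.length + β.length := by
  simp [append, length]

end FinPath

/-! ### Boundary paths as edge sequences, prefixes and shifts. -/

namespace BoundaryPath

/-- The `i`-th edge of a boundary path, if there is one. -/
def get : E.BoundaryPath → ℕ → Option A
  | fin α _, i => α.edges[i]?
  | inf p, i => some (p.edge i)

/-- A finite path has no edge at the index equal to its length, which separates it from an infinite
one. The source is needed only for paths of length zero, which have no edges. -/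
theorem ext_get {x y : E.BoundaryPath} (hs : x.source = y.source)
    (h : ∀ i, x.get i = y.get i) : x = y := by
  rcases x with ⟨α, hα⟩ | p <;> rcases y with ⟨β, hβ⟩ | q
  · congr 1
    exact FinPath.ext hs (List.ext_getElem? h)
  · simpa [get] using h α.edges.length
  · simpa [get] using h β.edges.length
  · congr 1
    exact InfPath.ext (funext fun i => by simpa [get] using h i)

@[simp] theorem source_prepend (α : E.FinPath) (x : E.BoundaryPath) (h : α.range = x.source) :
    (x.prepend α h).source = α.source := by
  rcases x with ⟨β, hβ⟩ | p
  · rfl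
  · rcases hα : α.edges with _ | ⟨e, l⟩
    · simpa [FinPath.range, hα, prepend, source, InfPath.prepend] using h.symm
    · simpa [prepend, source, InfPath.prepend, hα] using α.source_eq e (by simp [hα])

theorem get_prepend (α : E.FinPath) (x : E.BoundaryPath) (h : α.range = x.source) (i : ℕ) :
    (x.prepend α h).get i = if i < α.length then α.edges[i]? else x.get (i - α.length) := by
  rcases x with ⟨β, hβ⟩ | p
  · exact List.getElem?_append
  · by_cases hi : i < α.edges.length <;>
      simp [prepend, get, InfPath.prepend, FinPath.length, hi]

theorem get_prepend_add (α : E.FinPath) (x : E.BoundaryPath) (h : α.range = x.source) (i : ℕ) :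
    (x.prepend α h).get (α.length + i) = x.get i := by
  simp [get_prepend]

theorem prepend_nil (x : E.BoundaryPath) (w : V) (h : (FinPath.nil E w).range = x.source) :
    x.prepend (FinPath.nil E w) h = x :=
  ext_get (by simpa using h) fun i => by simp [get_prepend]

theorem prepend_append (α β : E.FinPath) (x : E.BoundaryPath) (h : α.range = β.source)
    (h' : (α.append β h).range = x.source) :
    x.prepend (α.append β h) h' =
      (x.prepend β ((FinPath.range_append α β h).symm.trans h')).prepend α (by simpa using h) := by
  refine ext_get (by simp) fun i => ?_
  have h1 : (α.append β h).edges[i]? =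
      if i < α.length then α.edges[i]? else β.edges[i - α.length]? := by
    rw [FinPath.edges_append, List.getElem?_append]
    rfl
  simp only [get_prepend, FinPath.length_append, h1]
  split_ifs <;> first | rfl | omega | (congr 1; omega)

theorem prepend_cancel {α β : E.FinPath} {x y : E.BoundaryPath} {hα : α.range = x.source}
    {hβ : β.range = y.source} (h : x.prepend α hα = y.prepend β hβ)
    (hl : α.length = β.length) : α = β ∧ x = y := by
  have hab : α = β := by
    refine FinPath.ext (by simpa using congrArg source h) (List.ext_getElem? fun i => ?_)
    have hi := congrArg (fun t => get t i) h
    simp only [get_prepend, hl] at hi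
    unfold FinPath.length at hl hi
    by_cases h' : i < β.edges.length
    · simpa [h'] using hi
    · rw [List.getElem?_eq_none (by omega), List.getElem?_eq_none (by omega)]
  subst hab
  refine ⟨rfl, ext_get (hα.symm.trans hβ) fun i => ?_⟩
  rw [← get_prepend_add α x hα, h, get_prepend_add]

/-- Trades the partially defined shift for concatenation, where edges can be compared through
`get_prepend`. -/
theorem shift_eq_some_iff {x z : E.BoundaryPath} :
    shift x = some z ↔ ∃ (e : A) (h : (FinPath.ofEdge E e).range = z.source),
      x = z.prepend (FinPath.ofEdge E e) h := by
  constructor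
  · rintro h
    rcases x with ⟨⟨w, _ | ⟨e, l⟩, hs, hc⟩, hx⟩ | p
    · simp [shift] at h
    · simp only [shift, Option.some.injEq] at h
      subst h
      refine ⟨e, rfl, ext_get ?_ fun i => ?_⟩
      · exact (hs e (by simp)).symm.trans (source_prepend (FinPath.ofEdge E e) _ _).symm
      · refine Eq.trans ?_ (get_prepend _ _ _ _).symm
        rcases i with _ | i <;> simp [get]
    · simp only [shift, Option.some.injEq] at h
      subst h
      refine ⟨p.edge 0, p.chain 0, ext_get ?_ fun i => ?_⟩
      · exact (source_prepend (FinPath.ofEdge E (p.edge 0)) _ _).symm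
      · refine Eq.trans ?_ (get_prepend _ _ _ _).symm
        rcases i with _ | i <;> simp [get]
  · rintro ⟨e, h, rfl⟩
    rcases z with ⟨⟨w, l, hs, hc⟩, hz⟩ | p
    · simp only [prepend, FinPath.append, FinPath.ofEdge, List.singleton_append, shift]
      have h' : E.r e = w := h
      subst h'
      rfl
    · simp only [prepend, shift, Option.some.injEq, inf.injEq]
      refine InfPath.ext (funext fun i => ?_)
      simp [InfPath.prepend, FinPath.ofEdge]

theorem exists_prepend_ofEdge {x : E.BoundaryPath} {e : A} (he : x.get 0 = some e) :
    ∃ (z : E.BoundaryPath) (h : (FinPath.ofEdge E e).range = z.source),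
      x = z.prepend (FinPath.ofEdge E e) h := by
  have hx : ∃ z, shift x = some z := by
    rcases x with ⟨⟨w, _ | ⟨e, l⟩, hs, hc⟩, hx⟩ | p
    · simp [get] at he
    · exact ⟨_, rfl⟩
    · exact ⟨_, rfl⟩
  obtain ⟨z, hz⟩ := hx
  obtain ⟨f, hf, rfl⟩ := shift_eq_some_iff.1 hz
  obtain rfl : f = e := by simpa [get_prepend] using he
  exact ⟨z, hf, rfl⟩

theorem shiftN_eq_some_iff {n : ℕ} {x z : E.BoundaryPath} :
    shiftN n x = some z ↔ ∃ (α : E.FinPath) (h : α.range = z.source),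
      α.length = n ∧ x = z.prepend α h := by
  induction n generalizing x with
  | zero =>
    constructor
    · intro h
      obtain rfl : x = z := by simpa [shiftN] using h
      exact ⟨FinPath.nil E x.source, rfl, rfl, (prepend_nil _ _ _).symm⟩
    · rintro ⟨α, h, hl, rfl⟩
      obtain rfl : α = FinPath.nil E z.source :=
        have he : α.edges = [] := List.length_eq_zero_iff.1 hl
        FinPath.ext (show α.source = z.source by simpa [FinPath.range, he] using h) he
      simp [shiftN, prepend_nil]
  | succ n ih =>
    constructor
    · intro h
      obtain ⟨y, hy, hz⟩ := Option.bind_eq_some_iff.1 h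
      obtain ⟨e, he, rfl⟩ := shift_eq_some_iff.1 hy
      obtain ⟨α, hα, hl, rfl⟩ := ih.1 hz
      have h1 : (FinPath.ofEdge E e).range = α.source := by simpa using he
      refine ⟨(FinPath.ofEdge E e).append α h1, by rw [FinPath.range_append, hα], ?_, ?_⟩
      · rw [FinPath.length_append, FinPath.length_ofEdge, hl, add_comm]
      · rw [prepend_append]
    · rintro ⟨α, h, hl, rfl⟩
      rcases α with ⟨w, _ | ⟨e, l⟩, hs, hc⟩
      · simp [FinPath.length] at hl
      · obtain rfl : E.s e = w := hs e (by simp)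
        let β : E.FinPath := ⟨E.r e, l, fun f hf => ((List.isChain_cons.1 hc).1 f hf).symm,
          (List.isChain_cons.1 hc).2⟩
        have h1 : (FinPath.ofEdge E e).range = β.source := rfl
        have h2 : β.range = z.source :=
          (FinPath.range_append (FinPath.ofEdge E e) β h1).symm.trans h
        refine Option.bind_eq_some_iff.2 ⟨z.prepend β h2, ?_, ih.2 ⟨β, h2, ?_, rfl⟩⟩
        · exact shift_eq_some_iff.2 ⟨e, by simp [β], prepend_append (FinPath.ofEdge E e) β z h1 h⟩
        · simpa [FinPath.length, β] using hl

theorem tailEquiv_prepend (α : E.FinPath) (x : E.BoundaryPath) (h : α.range = x.source) :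
    TailEquiv α.length (x.prepend α h) x :=
  ⟨α.length, 0, by simp, x, shiftN_eq_some_iff.2 ⟨α, h, rfl, rfl⟩, rfl⟩

/-- Puts tail equivalence in the shape of `basicZ`: each morphism lies in some `Z(α, β)`. -/
theorem tailEquiv_iff {k : ℤ} {x y : E.BoundaryPath} :
    TailEquiv k x y ↔ ∃ (α β : E.FinPath) (z : E.BoundaryPath) (hα : α.range = z.source)
      (hβ : β.range = z.source), (α.length : ℤ) - β.length = k ∧
      x = z.prepend α hα ∧ y = z.prepend β hβ := by
  constructor
  · rintro ⟨m, n, hk, z, hx, hy⟩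
    obtain ⟨α, hα, rfl, hx'⟩ := shiftN_eq_some_iff.1 hx
    obtain ⟨β, hβ, rfl, hy'⟩ := shiftN_eq_some_iff.1 hy
    exact ⟨α, β, z, hα, hβ, hk, hx', hy'⟩
  · rintro ⟨α, β, z, hα, hβ, hk, hx, hy⟩
    exact ⟨_, _, hk, z, shiftN_eq_some_iff.2 ⟨α, hα, rfl, hx⟩,
      shiftN_eq_some_iff.2 ⟨β, hβ, rfl, hy⟩⟩

/-- A common boundary path with prefixes `α`, `β`, where `α` is shorter: `β` extends `α`. -/
theorem exists_append_of_prepend_eq {α β : E.FinPath} {x y : E.BoundaryPath}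
    {hα : α.range = x.source} {hβ : β.range = y.source}
    (h : x.prepend α hα = y.prepend β hβ) (hl : α.length ≤ β.length) :
    ∃ (γ : E.FinPath) (h₁ : α.range = γ.source) (h₂ : γ.range = y.source),
      β = α.append γ h₁ ∧ x = y.prepend γ h₂ := by
  have hb : shiftN β.length (x.prepend α hα) = some y :=
    shiftN_eq_some_iff.2 ⟨β, hβ, rfl, h⟩
  obtain ⟨d, hd⟩ := Nat.exists_eq_add_of_le hl
  rw [hd, shiftN_add, shiftN_eq_some_iff.2 ⟨α, hα, rfl, rfl⟩, Option.bind_some] at hb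
  obtain ⟨γ, hγ, rfl, rfl⟩ := shiftN_eq_some_iff.1 hb
  have h1 : α.range = γ.source := by simpa using hα
  refine ⟨γ, h1, hγ, ?_, rfl⟩
  rw [← prepend_append α γ y h1 (by rw [FinPath.range_append, hγ])] at h
  exact (prepend_cancel h (by simp [hd])).1.symm

/-! ### Aperiodic boundary paths and existence of boundary paths. -/

/-- The isotropy group at a boundary path is trivial. -/
def IsAperiodic (x : E.BoundaryPath) : Prop := ∀ k, TailEquiv k x x → k = 0

/-- Conjugation by a morphism carries isotropy at `y` to isotropy at `x` with the same lag, since `l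
+ k - l = k`. -/
theorem IsAperiodic.of_tailEquiv {x y : E.BoundaryPath} {l : ℤ} (hx : x.IsAperiodic)
    (h : TailEquiv l x y) : y.IsAperiodic := by
  intro k hk
  have := hx _ ((h.trans hk).trans h.symm)
  omega

theorem IsAperiodic.prepend {x : E.BoundaryPath} (hx : x.IsAperiodic) (α : E.FinPath)
    (h : α.range = x.source) : (x.prepend α h).IsAperiodic :=
  hx.of_tailEquiv (tailEquiv_prepend α x h).symm

/-- If `γ = αδ = βδ`, comparing lengths forces `|α| = |β|`. -/
theorem isAperiodic_fin (γ : E.FinPath) (h : E.IsSingular γ.range) : (fin γ h).IsAperiodic := by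
  intro k hk
  obtain ⟨α, β, z, hα, hβ, rfl, hx, hy⟩ := tailEquiv_iff.1 hk
  rcases z with ⟨δ, hδ⟩ | p
  · have h : (α.append δ hα).length = (β.append δ hβ).length :=
      congrArg FinPath.length ((fin.inj hx).symm.trans (fin.inj hy))
    have h' := (FinPath.length_append α δ hα).symm.trans
      (h.trans (FinPath.length_append β δ hβ))
    omega
  · simp [BoundaryPath.prepend] at hx

theorem exists_period_of_tailEquiv {p : E.InfPath} {k : ℤ} (hk : k ≠ 0)
    (h : TailEquiv k (inf p) (inf p)) :
    ∃ m d, 0 < d ∧ ∀ i, p.edge (m + i) = p.edge (m + d + i) := by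
  obtain ⟨α, β, z, hα, hβ, hl, hx, hy⟩ := tailEquiv_iff.1 h
  have key : ∀ i, p.edge (α.length + i) = p.edge (β.length + i) := by
    intro i
    have h1 := congrArg (fun t => get t (α.length + i)) hx
    have h2 := congrArg (fun t => get t (β.length + i)) hy
    simp only [get_prepend_add] at h1 h2
    simpa [get] using h1.trans h2.symm
  rcases lt_or_gt_of_ne (show α.length ≠ β.length by omega) with hlt | hlt
  · obtain ⟨d, hd⟩ := Nat.exists_eq_add_of_le hlt.le
    exact ⟨α.length, d, by omega, fun i => by rw [key, hd]⟩
  · obtain ⟨d, hd⟩ := Nat.exists_eq_add_of_le hlt.le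
    exact ⟨β.length, d, by omega, fun i => by rw [← key, hd]⟩

/-- Either some finite path from `w` ends at a singular vertex, or every finite path from `w` can be
extended by an edge, and iterated extension gives an infinite path. -/
theorem exists_source_eq (E : DirGraph V A) (w : V) : ∃ x : E.BoundaryPath, x.source = w := by
  by_cases hw : ∃ α : E.FinPath, α.source = w ∧ E.IsSingular α.range
  · obtain ⟨α, rfl, h⟩ := hw
    exact ⟨fin α h, rfl⟩
  push Not at hw
  have hne : ∀ α : E.FinPath, α.source = w → ∃ e, E.s e = α.range := fun α hα => by
    have := hw α hα
    simp only [IsSingular, not_or] at this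
    exact Set.nonempty_iff_ne_empty.2 this.1
  choose next hnext using hne
  let step : {α : E.FinPath // α.source = w} → {α : E.FinPath // α.source = w} := fun α =>
    ⟨α.1.snoc (next α.1 α.2) (hnext α.1 α.2).symm, α.2⟩
  let path : ℕ → {α : E.FinPath // α.source = w} := fun n => step^[n] ⟨FinPath.nil E w, rfl⟩
  refine ⟨inf ⟨fun n => next (path n).1 (path n).2, fun n => ?_⟩, ?_⟩
  · rw [hnext]
    have h : path (n + 1) = step (path n) := Function.iterate_succ_apply' _ _ _
    rw [h]
    exact (FinPath.range_append (path n).1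
      (FinPath.ofEdge E (next (path n).1 (path n).2)) (hnext _ (path n).2).symm).symm
  · exact hnext _ _

end BoundaryPath

/-- The segment `pₐ … pₐ₊ₙ₋₁` of an infinite path. -/
def InfPath.segment (p : E.InfPath) (a n : ℕ) : E.FinPath where
  source := E.s (p.edge a)
  edges := (List.range n).map fun i => p.edge (a + i)
  source_eq := by
    rcases n with _ | n
    · simp
    · simp [List.range_succ_eq_map]
  chain := by
    refine List.isChain_iff_getElem.2 fun i _ => ?_
    simpa [add_assoc] using p.chain (a + i)

@[simp] theorem InfPath.length_segment (p : E.InfPath) (a n : ℕ) :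
    (p.segment a n).length = n := by
  simp [segment, FinPath.length]

theorem InfPath.range_segment (p : E.InfPath) (a n : ℕ) :
    (p.segment a n).range = E.s (p.edge (a + n)) := by
  rcases n with _ | n
  · simp [segment, FinPath.range]
  · simpa [segment, FinPath.range, List.range_succ, add_assoc] using p.chain (a + n)

theorem InfPath.getElem?_edges_segment (p : E.InfPath) {a n i : ℕ} (hi : i < n) :
    (p.segment a n).edges[i]? = some (p.edge (a + i)) := by
  simp [segment, hi]

/-! ### Condition (L) produces aperiodic paths. -/

namespace ConditionL

/-- Under Condition (L), an infinite path that repeats a vertex beyond its `N`-th edge admits a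
deviation beyond its `N`-th edge. -/
theorem exists_ne_edge (hL : E.ConditionL) (p : E.InfPath) {N n d : ℕ} (hn : N ≤ n) (hd : 0 < d)
    (h : E.s (p.edge n) = E.s (p.edge (n + d))) :
    ∃ j f, N ≤ j ∧ E.s f = E.s (p.edge j) ∧ f ≠ p.edge j := by
  classical
  -- Take the shortest return to a vertex beyond `N`: a repeated vertex inside it would give a
  -- shorter one, so the segment is a cycle and has an exit.
  have hex : ∃ d, 0 < d ∧ ∃ n, N ≤ n ∧ E.s (p.edge n) = E.s (p.edge (n + d)) :=
    ⟨d, hd, n, hn, h⟩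
  obtain ⟨hc, a, ha, hav⟩ := Nat.find_spec hex
  have hmin := fun k hk => Nat.find_min hex (m := k) hk
  generalize Nat.find hex = c at hc hav hmin
  obtain ⟨f, i, hi, hf, hne⟩ := hL (p.segment a c) ⟨⟨by simpa using hc,
      (p.range_segment a c).trans hav.symm⟩, by
    refine List.nodup_iff_injective_getElem.2 fun i j hij => ?_
    by_contra hne
    obtain ⟨i, hi⟩ := i
    obtain ⟨j, hj⟩ := j
    have key : ∀ i j : ℕ, j < c → i < j → E.s (p.edge (a + i)) ≠ E.s (p.edge (a + j)) := by
      intro i j hj hlt he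
      refine hmin (j - i) (by omega) ⟨by omega, a + i, by omega, ?_⟩
      rw [he, show a + i + (j - i) = a + j by omega]
    simp only [InfPath.segment, List.length_map, List.length_range] at hi hj
    simp only [InfPath.segment, List.getElem_map, List.getElem_range] at hij
    rcases lt_trichotomy i j with hlt | rfl | hlt
    · exact key i j hj hlt hij
    · exact hne rfl
    · exact key j i hi hlt hij.symm⟩
  have hi' : i < c := by simpa [InfPath.segment] using hi
  have he : (p.segment a c).edges[i] = p.edge (a + i) :=
    Option.some_injective _ <| by
      rw [← List.getElem?_eq_getElem hi, p.getElem?_edges_segment hi']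
  rw [he] at hf hne
  exact ⟨a + i, f, by omega, hf, hne⟩

/-- Under Condition (L), every vertex is the source of a boundary path with trivial isotropy. -/
theorem exists_isAperiodic (hL : E.ConditionL) (w : V) :
    ∃ x : E.BoundaryPath, x.source = w ∧ x.IsAperiodic := by
  by_contra! hcon
  -- Finite boundary paths are aperiodic, so every boundary path from `w` is infinite and eventually
  -- periodic.
  have hinf : ∀ x : E.BoundaryPath, x.source = w → ∃ p : E.InfPath, x = .inf p ∧
      ∃ m d, 0 < d ∧ ∀ i, p.edge (m + i) = p.edge (m + d + i) := by
    intro x hx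
    have hnx := hcon x hx
    rcases x with ⟨α, hα⟩ | p
    · exact absurd (BoundaryPath.isAperiodic_fin α hα) hnx
    · simp only [BoundaryPath.IsAperiodic, not_forall] at hnx
      obtain ⟨k, hk, hk0⟩ := hnx
      exact ⟨p, rfl, BoundaryPath.exists_period_of_tailEquiv hk0 hk⟩
  let _ : TopologicalSpace A := ⊥
  have : DiscreteTopology A := ⟨rfl⟩
  let X : Set (ℕ → A) := {f | E.s (f 0) = w ∧ ∀ i, E.r (f i) = E.s (f (i + 1))}
  have hX : IsClosed X := by
    let _ : TopologicalSpace V := ⊥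
    have : DiscreteTopology V := ⟨rfl⟩
    have hs : Continuous E.s := continuous_of_discreteTopology
    have hr : Continuous E.r := continuous_of_discreteTopology
    have h : X = {f | E.s (f 0) = w} ∩ ⋂ i, {f | E.r (f i) = E.s (f (i + 1))} := by
      ext f
      simp [X]
    rw [h]
    exact (isClosed_eq (by fun_prop) (by fun_prop)).inter
      (isClosed_iInter fun i => isClosed_eq (by fun_prop) (by fun_prop))
  -- The paths with preperiod `t.1` and period `t.2`; countably many closed sets that cover `X`.
  let P : ℕ × ℕ → Set X := fun t =>
    {f | 0 < t.2 ∧ ∀ i, f.1 (t.1 + i) = f.1 (t.1 + t.2 + i)}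
  have hP : ∀ t, IsClosed (P t) := by
    intro t
    have h : P t = {_f | 0 < t.2} ∩ ⋂ i, {f | f.1 (t.1 + i) = f.1 (t.1 + t.2 + i)} := by
      ext f
      simp [P]
    rw [h]
    have hcont : ∀ j, Continuous fun f : X => f.1 j := fun j =>
      (continuous_apply j).comp continuous_subtype_val
    exact isClosed_const.inter (isClosed_iInter fun i => isClosed_eq (hcont _) (hcont _))
  have hU : ⋃ t, P t = Set.univ := by
    refine Set.eq_univ_of_forall fun f => ?_
    obtain ⟨p, hp, m, d, hd, h⟩ := hinf (.inf ⟨f.1, f.2.2⟩) f.2.1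
    obtain rfl : _ = p := BoundaryPath.inf.inj hp
    exact Set.mem_iUnion.2 ⟨(m, d), hd, h⟩
  have : TopologicalSpace.IsCompletelyPseudoMetrizableSpace X := hX.isCompletelyPseudoMetrizableSpace
  have : Nonempty X := by
    obtain ⟨x, hx⟩ := BoundaryPath.exists_source_eq E w
    obtain ⟨p, rfl, -⟩ := hinf x hx
    exact ⟨⟨p.edge, hx, p.chain⟩⟩
  -- Baire category theorem, applicable because `X` is closed in a countable product of discrete
  -- spaces.
  obtain ⟨⟨m, d⟩, p, hp⟩ := nonempty_interior_of_iUnion_of_closed hP hU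
  obtain ⟨O, hO, hpO, hOP⟩ : ∃ O : Set (ℕ → A), IsOpen O ∧ p.1 ∈ O ∧
      ∀ q : X, q.1 ∈ O → q ∈ P (m, d) := by
    obtain ⟨U, hUP, ⟨O, hO, rfl⟩, hpU⟩ := mem_interior.1 hp
    exact ⟨O, hO, hpU, fun q hq => hUP hq⟩
  obtain ⟨I, u, hu, hI⟩ := isOpen_pi_iff.1 hO p.1 hpO
  have hd : 0 < d := (interior_subset hp).1
  have hper : ∀ i, p.1 (m + i) = p.1 (m + d + i) := (interior_subset hp).2
  -- `N` exceeds each coordinate in `I`, so agreement below `N` puts a path in the neighbourhood of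
  -- `p`, and it exceeds `m + d`, so periodicity determines each edge from index `N` on by the edge
  -- `d` places earlier.
  let N := m + d + I.sup id + 1
  have hforced : ∀ q : X, (∀ i < N, q.1 i = p.1 i) → ∀ i, q.1 i = p.1 i := by
    intro q hq
    have hqP : q ∈ P (m, d) := hOP q <| hI fun i hi => by
      have : i ≤ I.sup id := Finset.le_sup (f := id) hi
      rw [hq i (by omega)]
      exact (hu i hi).2
    intro i
    induction i using Nat.strong_induction_on with
    | _ i ih =>
      by_cases hi : i < N
      · exact hq i hi
      · have h1 := hqP.2 (i - (m + d))
        have h2 := hper (i - (m + d))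
        rw [show m + d + (i - (m + d)) = i by omega] at h2
        rw [show m + d + (i - (m + d)) = i by omega, ih _ (by omega)] at h1
        rw [← h1, h2]
  let p' : E.InfPath := ⟨p.1, p.2.2⟩
  -- Leaving `p` at `j ≥ N` along `f` and continuing arbitrarily gives a boundary path from `w`,
  -- infinite by `hinf`, that contradicts `hforced`.
  obtain ⟨j, f, hj, hf, hne⟩ := hL.exists_ne_edge p' (N := N) le_rfl hd (by
    have := hper (N - m)
    rw [show m + (N - m) = N by omega, show m + d + (N - m) = N + d by omega] at this
    exact congrArg E.s this)
  obtain ⟨x, hx⟩ := BoundaryPath.exists_source_eq E (E.r f)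
  have h1 : (FinPath.ofEdge E f).range = x.source := hx.symm
  have h2 : (p'.segment 0 j).range = (x.prepend (FinPath.ofEdge E f) h1).source := by
    rw [BoundaryPath.source_prepend, InfPath.range_segment, FinPath.source_ofEdge, hf, zero_add]
  obtain ⟨q, hq, -⟩ := hinf ((x.prepend (FinPath.ofEdge E f) h1).prepend (p'.segment 0 j) h2) (by
    rw [BoundaryPath.source_prepend]
    exact p.2.1)
  have hget : ∀ i, some (q.edge i) =
      if i < j then (p'.segment 0 j).edges[i]? else
        (x.prepend (FinPath.ofEdge E f) h1).get (i - j) := fun i => by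
    have := congrArg (fun t => BoundaryPath.get t i) hq
    simp only [BoundaryPath.get_prepend _ _ h2, InfPath.length_segment] at this
    exact this.symm
  have hlt : ∀ i < j, q.edge i = p.1 i := fun i hi => by
    have := hget i
    rw [if_pos hi, p'.getElem?_edges_segment hi, zero_add] at this
    exact Option.some_injective _ this
  have hqj : q.edge j = f := by
    simpa [BoundaryPath.get_prepend] using hget j
  have hq0 : E.s (q.edge 0) = w := by
    rw [hlt 0 (by omega)]
    exact p.2.1
  exact hne (hqj.symm.trans
    (hforced ⟨q.edge, hq0, q.chain⟩ (fun i hi => hlt i (by omega)) j))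

/-- Under Condition (L), boundary paths with trivial isotropy are dense among all boundary paths. -/
theorem exists_isAperiodic_get_ne (hL : E.ConditionL) (z : E.BoundaryPath) (F : Finset A)
    (hz : ∀ e ∈ F, z.get 0 ≠ some e) :
    ∃ x : E.BoundaryPath, x.source = z.source ∧ x.IsAperiodic ∧ ∀ e ∈ F, x.get 0 ≠ some e := by
  -- A path without edges is already aperiodic. Otherwise the first edge is kept, so that `F` is
  -- still avoided, and only the rest is replaced.
  rcases h0 : z.get 0 with _ | e
  · rcases z with ⟨α, hα⟩ | p
    · exact ⟨_, rfl, BoundaryPath.isAperiodic_fin α hα, hz⟩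
    · simp [BoundaryPath.get] at h0
  · obtain ⟨y, hy, rfl⟩ := BoundaryPath.exists_prepend_ofEdge h0
    obtain ⟨x, hx, hxa⟩ := hL.exists_isAperiodic y.source
    refine ⟨x.prepend (FinPath.ofEdge E e) (hy.trans hx.symm), by simp, hxa.prepend _ _, ?_⟩
    simpa [BoundaryPath.get_prepend] using hz

end ConditionL

/-! ### Cycles without an exit. -/

/-- All boundary paths starting at the source of a cycle without an exit coincide. -/
theorem FinPath.IsCycle.eq_of_source_eq {c : E.FinPath} (hc : c.IsCycle)
    (hne : ∀ f, ¬ c.IsExit f) {x y : E.BoundaryPath} (hx : x.source = c.source)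
    (hy : y.source = c.source) : x = y := by
  have hn : 0 < c.edges.length := hc.1.1
  have h0 : E.s c.edges[0] = c.source := c.source_eq _ (by simp [List.head?_eq_getElem?])
  have hnext : ∀ j (hj : j < c.edges.length),
      E.r c.edges[j] = E.s (c.edges[(j + 1) % c.edges.length]'(Nat.mod_lt _ hn)) := by
    intro j hj
    by_cases hj' : j + 1 < c.edges.length
    · simp only [Nat.mod_eq_of_lt hj']
      exact List.isChain_iff_getElem.1 c.chain j hj'
    · have hj1 : j + 1 = c.edges.length := by omega
      have hl : c.edges.getLast? = some c.edges[j] := by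
        rw [List.getLast?_eq_getElem?, ← hj1]
        exact List.getElem?_eq_getElem hj
      have hr : c.range = E.r c.edges[j] := by simp [FinPath.range, hl]
      simp only [hj1, Nat.mod_self]
      rw [← hr, h0, hc.1.2]
  have hfst : ∀ j (hj : j < c.edges.length) (x : E.BoundaryPath), x.source = E.s c.edges[j] →
      x.get 0 = some c.edges[j] := by
    intro j hj x hx
    -- Without an exit each vertex of `c` emits exactly one edge. It is therefore not singular, so a
    -- boundary path can neither stop there nor choose.
    have hemit : {e | E.s e = E.s c.edges[j]} = {c.edges[j]} := by
      ext e
      refine ⟨fun he => ?_, fun he => by rw [Set.mem_singleton_iff.1 he]; rfl⟩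
      by_contra h
      exact hne e ⟨j, hj, he, h⟩
    rcases x with ⟨⟨w, _ | ⟨e, l⟩, hs, hch⟩, hα⟩ | p
    · have hw : w = E.s c.edges[j] := hx
      subst hw
      have hα' : E.IsSingular (E.s c.edges[j]) := hα
      simp [IsSingular, hemit] at hα'
    · have he : e ∈ {e | E.s e = E.s c.edges[j]} := (hs e (by simp)).trans hx
      rw [hemit] at he
      exact congrArg some he
    · have he : p.edge 0 ∈ {e | E.s e = E.s c.edges[j]} := hx
      rw [hemit] at he
      exact congrArg some he
  -- The starting position `j` must vary in the induction on `i`: deleting the first edge moves it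
  -- to `j + 1`, taken modulo the length of `c`.
  have key : ∀ i j (hj : j < c.edges.length) (x : E.BoundaryPath), x.source = E.s c.edges[j] →
      x.get i = some (c.edges[(j + i) % c.edges.length]'(Nat.mod_lt _ hn)) := by
    intro i
    induction i with
    | zero =>
      intro j hj x hx
      simpa [Nat.mod_eq_of_lt hj] using hfst j hj x hx
    | succ i ih =>
      intro j hj x hx
      obtain ⟨z, hz, rfl⟩ := BoundaryPath.exists_prepend_ofEdge (hfst j hj x hx)
      have := ih _ (Nat.mod_lt (j + 1) hn) z (hz.symm.trans (hnext j hj))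
      simpa [BoundaryPath.get_prepend, add_assoc, add_comm 1 i] using this
  refine BoundaryPath.ext_get (hx.trans hy.symm) fun i => ?_
  rw [key i 0 hn x (hx.trans h0.symm), key i 0 hn y (hy.trans h0.symm)]

/-! ### Morphisms and basic neighbourhoods in the groupoid. -/

namespace GE

theorem ext_lag {g h : E.GE} (hl : g.left = h.left) (hr : g.right = h.right)
    (hk : lag g = lag h) : g = h := by
  rcases g with ⟨y, x, k⟩
  rcases h with ⟨y', x', k'⟩
  obtain rfl : y = y' := hl
  obtain rfl : x = x' := hr
  obtain rfl : k = k' := Subtype.ext hk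
  rfl

theorem tailEquiv (g : E.GE) : BoundaryPath.TailEquiv (lag g) g.right g.left := g.hom.2

/-- The morphism `(x, k, y)`. -/
def mk {k : ℤ} {x y : E.BoundaryPath} (h : BoundaryPath.TailEquiv k x y) : E.GE :=
  ⟨y, x, (⟨k, h⟩ : {k : ℤ // BoundaryPath.TailEquiv k x y})⟩

@[simp] theorem lag_mk {k : ℤ} {x y : E.BoundaryPath} (h : BoundaryPath.TailEquiv k x y) :
    lag (mk h) = k := rfl

theorem mem_units_iff (g : E.GE) :
    g ∈ TopGroupoid.units E.BoundaryPath ↔ g.left = g.right ∧ lag g = 0 := by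
  constructor
  · rintro ⟨x, rfl⟩
    exact ⟨rfl, rfl⟩
  · rintro ⟨h, h0⟩
    exact ⟨g.left, ext_lag rfl h h0.symm⟩

end GE

theorem basicZF_empty (α β : E.FinPath) : basicZF α β ∅ = basicZ α β := by
  simp [basicZF]

theorem isOpen_basicZ {α β : E.FinPath} (h : α.range = β.range) : IsOpen (basicZ α β) :=
  TopologicalSpace.isOpen_generateFrom_of_mem
    ⟨α, β, ∅, h, by simp, (basicZF_empty α β).symm⟩

/-- `U` contains all `(αx, |α| - |β|, βx)` for which the first edge of `x` is not in `F`. -/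
def ContainsZ (U : Set E.GE) (α β : E.FinPath) (F : Finset A) : Prop :=
  ∀ (x : E.BoundaryPath) (hα : α.range = x.source) (hβ : β.range = x.source) (g : E.GE),
    (∀ e ∈ F, x.get 0 ≠ some e) → g.right = x.prepend α hα →
    GE.lag g = (α.length : ℤ) - β.length → g.left = x.prepend β hβ → g ∈ U

/-- `g` has the form `(αx, |α| - |β|, βx)`, where the first edge of `x` is not in `F`, and `U`
contains all elements of this form. -/
def IsZNhd (U : Set E.GE) (g : E.GE) : Prop :=
  ∃ (α β : E.FinPath) (F : Finset A) (x : E.BoundaryPath) (hα : α.range = x.source)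
    (hβ : β.range = x.source), (∀ e ∈ F, x.get 0 ≠ some e) ∧ g.right = x.prepend α hα ∧
    GE.lag g = (α.length : ℤ) - β.length ∧ g.left = x.prepend β hβ ∧ ContainsZ U α β F

theorem IsZNhd.inter {U U' : Set E.GE} {g : E.GE} (h : IsZNhd U g) (h' : IsZNhd U' g) :
    IsZNhd (U ∩ U') g := by
  classical
  have key : ∀ {U U' : Set E.GE} {α β α' β' : E.FinPath} {F F' : Finset A}
      {x x' : E.BoundaryPath} {hα : α.range = x.source} {hβ : β.range = x.source}
      {hα' : α'.range = x'.source} {hβ' : β'.range = x'.source},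
      α.length ≤ α'.length → (∀ e ∈ F, x.get 0 ≠ some e) → (∀ e ∈ F', x'.get 0 ≠ some e) →
      g.right = x.prepend α hα → g.left = x.prepend β hβ →
      GE.lag g = (α.length : ℤ) - β.length →
      g.right = x'.prepend α' hα' → g.left = x'.prepend β' hβ' →
      GE.lag g = (α'.length : ℤ) - β'.length →
      ContainsZ U α β F → ContainsZ U' α' β' F' → IsZNhd (U ∩ U') g := by
    -- The longer pair is `(αγ, βγ)` for a common `γ`: comparing codomains gives `α' = αγ`, and the
    -- equal lags then force `β' = βγ`.
    intro U U' α β α' β' F F' x x' hα hβ hα' hβ' hle hF hF' hr hl hk hr' hl' hk' hU hU'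
    obtain ⟨γ, hγ, hγ', rfl, rfl⟩ :=
      BoundaryPath.exists_append_of_prepend_eq (hr.symm.trans hr') hle
    have hβγ : β.range = γ.source := by simpa using hβ
    have hβγ' : (β.append γ hβγ).range = x'.source := by rw [FinPath.range_append, hγ']
    have h1 : x'.prepend (β.append γ hβγ) hβγ' = x'.prepend β' hβ' := by
      rw [BoundaryPath.prepend_append, ← hl', hl]
    obtain ⟨rfl, -⟩ := BoundaryPath.prepend_cancel h1 (by
      have := FinPath.length_append α γ hγ
      have := FinPath.length_append β γ hβγ
      omega)
    -- If `γ` has an edge, the first edge of `γy` is that of `γ`, which already avoids `F`; only for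
    -- trivial `γ` must `F` be imposed on `y`.
    refine ⟨α.append γ hγ, β.append γ hβγ, if γ.edges = [] then F ∪ F' else F', x', hα', hβ', ?_,
      hr', hk', hl', fun y hαy hβy h hy hry hky hly => ⟨?_, ?_⟩⟩
    · split_ifs with hγ0
      · intro e he
        rcases Finset.mem_union.1 he with he | he
        · simpa [BoundaryPath.get_prepend, FinPath.length, hγ0] using hF e he
        · exact hF' e he
      · exact hF'
    · have hγy : γ.range = y.source := by rw [← hαy, FinPath.range_append]
      rw [BoundaryPath.prepend_append] at hry hly
      refine hU (y.prepend γ hγy) _ _ h (fun e he => ?_) hry ?_ hly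
      · by_cases hγ0 : γ.edges = []
        · have := hy e (by simp [hγ0, he])
          simpa [BoundaryPath.get_prepend, FinPath.length, hγ0] using this
        · have hlen : 0 < γ.length := List.length_pos_iff.2 hγ0
          have := hF e he
          rw [BoundaryPath.get_prepend, if_pos hlen] at this ⊢
          exact this
      · rw [hky, FinPath.length_append, FinPath.length_append]
        push_cast
        ring
    · refine hU' y hαy hβy h (fun e he => hy e ?_) hry hky hly
      split_ifs
      · exact Finset.mem_union_right _ he
      · exact he
  obtain ⟨α, β, F, x, hα, hβ, hF, hr, hk, hl, hU⟩ := h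
  obtain ⟨α', β', F', x', hα', hβ', hF', hr', hk', hl', hU'⟩ := h'
  rcases le_total α.length α'.length with hle | hle
  · exact key hle hF hF' hr hl hk hr' hl' hk' hU hU'
  · rw [Set.inter_comm]
    exact key hle hF' hF hr' hl' hk' hr hl hk hU' hU

/-- By cancellation, `(αx, |α| - |β|, βx)` lies in `Z(αe, βe)` exactly when `x` begins with `e`. -/
theorem isZNhd_basicZF {α β : E.FinPath} {F : Finset A} (hF : ∀ e ∈ F, E.s e = α.range)
    (hr : α.range = β.range) {g : E.GE} (hg : g ∈ basicZF α β F) : IsZNhd (basicZF α β F) g := by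
  obtain ⟨⟨x, hα, hβ, hgr, hgk, hgl⟩, hn⟩ := hg
  refine ⟨α, β, F, x, hα, hβ, fun e he h0 => hn ?_, hgr, hgk, hgl, ?_⟩
  · obtain ⟨z, hz, rfl⟩ := BoundaryPath.exists_prepend_ofEdge h0
    refine ⟨e, he, (hF e he).symm, hr.symm.trans (hF e he).symm, z, ?_, ?_, ?_, ?_, ?_⟩
    · exact (FinPath.range_append _ _ _).trans hz
    · exact (FinPath.range_append _ _ _).trans hz
    · rw [hgr]
      exact (BoundaryPath.prepend_append α (FinPath.ofEdge E e) z _ _).symm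
    · rw [hgk]
      have h1 := FinPath.length_append α (FinPath.ofEdge E e) (hF e he).symm
      have h2 := FinPath.length_append β (FinPath.ofEdge E e) (hr.symm.trans (hF e he).symm)
      simp only [FinPath.length_ofEdge] at h1 h2
      unfold FinPath.snoc
      omega
    · rw [hgl]
      exact (BoundaryPath.prepend_append β (FinPath.ofEdge E e) z _ _).symm
  · intro y hαy hβy h hy hhr hhk hhl
    refine ⟨⟨y, hαy, hβy, hhr, hhk, hhl⟩, ?_⟩
    rintro ⟨e, he, hαe, hβe, z, hαz, hβz, hhr', -, -⟩
    have h1 := hhr.symm.trans (hhr'.trans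
      (BoundaryPath.prepend_append α (FinPath.ofEdge E e) z hαe hαz))
    refine hy e he ?_
    rw [(BoundaryPath.prepend_cancel h1 rfl).2]
    simp [BoundaryPath.get_prepend]

theorem isZNhd_univ (g : E.GE) : IsZNhd Set.univ g := by
  obtain ⟨α, β, z, hα, hβ, hk, hx, hy⟩ := BoundaryPath.tailEquiv_iff.1 (GE.tailEquiv g)
  exact ⟨α, β, ∅, z, hα, hβ, by simp, hx, hk.symm, hy, fun _ _ _ _ _ _ _ _ => trivial⟩

/-- The generating sets behave as a base: the property passes through finite intersections by
`IsZNhd.inter`, and through unions by monotonicity. -/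
theorem isZNhd_of_isOpen {U : Set E.GE} (hU : IsOpen U) {g : E.GE} (hg : g ∈ U) :
    IsZNhd U g := by
  induction hU generalizing g with
  | basic S hS =>
    obtain ⟨α, β, F, hr, hF, rfl⟩ := hS
    exact isZNhd_basicZF hF hr hg
  | univ => exact isZNhd_univ g
  | inter S T _ _ ihS ihT => exact (ihS hg.1).inter (ihT hg.2)
  | sUnion 𝒮 _ ih =>
    obtain ⟨S, hS, hgS⟩ := hg
    obtain ⟨α, β, F, x, hα, hβ, hF, hr, hk, hl, h⟩ := ih S hS hgS
    exact ⟨α, β, F, x, hα, hβ, hF, hr, hk, hl, fun y h1 h2 g' h3 h4 h5 h6 =>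
      ⟨S, hS, h y h1 h2 g' h3 h4 h5 h6⟩⟩

/-- The units are the union of the sets `Z(w, w)` over the vertices `w`. -/
theorem isOpen_units : IsOpen (TopGroupoid.units E.BoundaryPath) := by
  have : TopGroupoid.units E.BoundaryPath =
      ⋃ w : V, basicZ (FinPath.nil E w) (FinPath.nil E w) := by
    ext g
    rw [GE.mem_units_iff, Set.mem_iUnion]
    constructor
    · rintro ⟨h, h0⟩
      exact ⟨g.right.source, g.right, rfl, rfl, (BoundaryPath.prepend_nil _ _ _).symm, by simp [h0],
        h.trans (BoundaryPath.prepend_nil _ _ _).symm⟩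
    · rintro ⟨w, x, _, _, hr, hk, hl⟩
      exact ⟨hl.trans hr.symm, by simpa using hk⟩
  rw [this]
  exact isOpen_iUnion fun w => isOpen_basicZ rfl

/-! ### From Condition (L) to the groupoid properties. -/

theorem ConditionL.isEffective (hL : E.ConditionL) : TopGroupoid.IsEffective E.BoundaryPath := by
  refine Set.Subset.antisymm (fun g hg => ?_) (isOpen_units.subset_interior_iff.2 fun g hg => ?_)
  · refine (GE.mem_units_iff g).2
      ⟨interior_subset (s := TopGroupoid.isotropy E.BoundaryPath) hg, ?_⟩
    obtain ⟨α, β, F, x, hα, hβ, hF, hr, hk, hl, h⟩ := isZNhd_of_isOpen isOpen_interior hg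
    -- The morphism `(αz, |α| - |β|, βz)` stays in the interior of the isotropy, so `αz = βz`;
    -- aperiodicity then kills the lag, which is also that of `g`.
    obtain ⟨z, hz, hza, hzF⟩ := hL.exists_isAperiodic_get_ne x F hF
    have hα' := hα.trans hz.symm
    have hβ' := hβ.trans hz.symm
    have hT : BoundaryPath.TailEquiv ((α.length : ℤ) - β.length) (z.prepend α hα')
        (z.prepend β hβ') := BoundaryPath.tailEquiv_iff.2 ⟨α, β, z, hα', hβ', rfl, rfl, rfl⟩
    have hiso : z.prepend β hβ' = z.prepend α hα' :=
      interior_subset (s := TopGroupoid.isotropy E.BoundaryPath) (h z hα' hβ' (GE.mk hT) hzF rfl rfl rfl)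
    rw [hiso] at hT
    rw [hk]
    exact hza.prepend α hα' _ hT
  · exact ((GE.mem_units_iff g).1 hg).1

theorem ConditionL.isTopologicallyPrincipal (hL : E.ConditionL) :
    TopGroupoid.IsTopologicallyPrincipal E.BoundaryPath := by
  refine dense_iff_inter_open.2 ?_
  rintro _ ⟨U, hU, rfl⟩ ⟨⟨g, hg⟩, hgU⟩
  obtain ⟨α, β, F, x, hα, hβ, hF, hr, hk, hl, h⟩ := isZNhd_of_isOpen hU hgU
  obtain ⟨hlr, hk0⟩ := (GE.mem_units_iff g).1 hg
  -- A unit has lag `0`, so `|α| = |β|` and hence `α = β`; the nearby elements `(αz, 0, αz)` are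
  -- again units.
  obtain ⟨rfl, -⟩ := BoundaryPath.prepend_cancel (hr.symm.trans (hlr.symm.trans hl)) (by
    rw [show GE.lag g = 0 from hk0] at hk
    omega)
  obtain ⟨z, hz, hza, hzF⟩ := hL.exists_isAperiodic_get_ne x F hF
  have hα' := hα.trans hz.symm
  let u : E.GE := GE.mk (BoundaryPath.TailEquiv.refl (z.prepend α hα'))
  refine ⟨⟨u, (GE.mem_units_iff u).2 ⟨rfl, rfl⟩⟩, h z hα' hα' u hzF rfl (by simp [u]) rfl, ?_⟩
  refine Set.eq_singleton_iff_unique_mem.2 ⟨⟨rfl, rfl⟩, fun t ht => ?_⟩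
  obtain ⟨hr', hl'⟩ : t.right = z.prepend α hα' ∧ t.left = z.prepend α hα' := ht
  refine GE.ext_lag hl' hr' ?_
  have := GE.tailEquiv t
  rw [hr', hl'] at this
  exact hza.prepend α hα' _ this

/-! ### From the groupoid properties to Condition (L). -/

/-- If `c` is a cycle without an exit, then `ccc…` is fixed by prepending `c`. -/
theorem FinPath.IsCycle.exists_prepend_eq {c : E.FinPath} (hc : c.IsCycle)
    (hne : ∀ f, ¬ c.IsExit f) : ∃ (x : E.BoundaryPath) (h : c.range = x.source),
      x.prepend c h = x ∧ BoundaryPath.TailEquiv c.length x x := by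
  obtain ⟨x, hx⟩ := BoundaryPath.exists_source_eq E c.source
  have h : c.range = x.source := hc.1.2.trans hx.symm
  have he : x.prepend c h = x := hc.eq_of_source_eq hne (by simp) hx
  refine ⟨x, h, he, ?_⟩
  have := BoundaryPath.tailEquiv_prepend c x h
  rwa [he] at this

theorem conditionL_of_isEffective (h : TopGroupoid.IsEffective E.BoundaryPath) :
    E.ConditionL := by
  by_contra hL
  simp only [ConditionL, not_forall, not_exists] at hL
  obtain ⟨c, hc, hne⟩ := hL
  obtain ⟨x, hx, he, hT⟩ := hc.exists_prepend_eq hne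
  have hxc : x.source = c.source := hx.symm.trans hc.1.2
  have hmem : GE.mk hT ∈ interior (TopGroupoid.isotropy E.BoundaryPath) := by
    -- Domains and codomains of elements of `Z(c, s(c))` all start at `s(c)`, hence coincide, so
    -- this open set consists of isotropy.
    refine mem_interior.2 ⟨basicZ c (FinPath.nil E c.source), ?_, isOpen_basicZ hc.1.2,
      x, hx, hxc.symm, he.symm, by simp, (BoundaryPath.prepend_nil _ _ _).symm⟩
    rintro g ⟨y, hy, hy', hr, -, hl⟩
    refine hl.trans (Eq.trans ?_ hr.symm)
    exact hc.eq_of_source_eq hne (by simp) (by simp)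
  rw [h] at hmem
  have h0 : (c.length : ℤ) = 0 := ((GE.mem_units_iff _).1 hmem).2
  have := hc.1.1
  omega

theorem conditionL_of_isTopologicallyPrincipal
    (h : TopGroupoid.IsTopologicallyPrincipal E.BoundaryPath) : E.ConditionL := by
  by_contra hL
  simp only [ConditionL, not_forall, not_exists] at hL
  obtain ⟨c, hc, hne⟩ := hL
  obtain ⟨x, hx, he, hT⟩ := hc.exists_prepend_eq hne
  have hxc : x.source = c.source := hx.symm.trans hc.1.2
  let W : Set E.GE := basicZ (FinPath.nil E c.source) (FinPath.nil E c.source)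
  let u : E.GE := GE.mk (BoundaryPath.TailEquiv.refl x)
  -- The only unit in `W` is the one at `x`, so density forces trivial isotropy at `x`, against the
  -- element of lag `|c|`.
  obtain ⟨⟨t, ht⟩, htW, htu⟩ := dense_iff_inter_open.1 h
    (Subtype.val ⁻¹' W) ((isOpen_basicZ rfl).preimage continuous_subtype_val)
    ⟨⟨u, (GE.mem_units_iff u).2 ⟨rfl, rfl⟩⟩, x, hxc.symm, hxc.symm,
      (BoundaryPath.prepend_nil _ _ _).symm, by simp [u], (BoundaryPath.prepend_nil _ _ _).symm⟩
  obtain ⟨y, _, _, -, -, hl⟩ := htW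
  have htx : t.left = x := by
    refine hc.eq_of_source_eq hne ?_ hxc
    change t.left = _ at hl
    rw [hl]
    simp
  have hmem : GE.mk hT ∈ {g : E.GE | g.right = t.left ∧ g.left = t.left} := ⟨htx.symm, htx.symm⟩
  have htu' : {g : E.GE | g.right = t.left ∧ g.left = t.left} = {t} := htu
  rw [htu'] at hmem
  have h0 : (c.length : ℤ) = 0 := by
    have h1 := congrArg GE.lag (Set.mem_singleton_iff.1 hmem)
    rw [((GE.mem_units_iff t).1 ht).2] at h1
    exact h1
  have := hc.1.1
  omega

end DirGraph

theorem mainTheorem9 {V : Type u} {A : Type v} (E : DirGraph V A) :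
    [TopGroupoid.IsEffective E.BoundaryPath,
      TopGroupoid.IsTopologicallyPrincipal E.BoundaryPath,
      E.ConditionL].TFAE := by
  tfae_have 1 → 3 := DirGraph.conditionL_of_isEffective
  tfae_have 2 → 3 := DirGraph.conditionL_of_isTopologicallyPrincipal
  tfae_have 3 → 1 := DirGraph.ConditionL.isEffective
  tfae_have 3 → 2 := DirGraph.ConditionL.isTopologicallyPrincipal
  tfae_finish
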